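/- Let $L$ be a countable first-order language (with relation and function symbols of finite arities), and let $\mathrm{Mod}(L)$ be the space of all $L$-structures with domain $\omega$, that is, the product of the spaces $\omega^{\omega^n}$ over the $n$-ary function symbols and $\{0,1\}^{\omega^n}$ over the $n$-ary relation symbols of $L$ (for all $n\in\omega$), with the product topology, where $\omega$ and $\{0,1\}$ are discrete. Let $\mathbf{K}$ be a Borel subset of $\mathrm{Mod}(L)$ such that the automorphism group $\mathrm{Aut}(A)$ is countable (finite or countably infinite) for every $A \in \mathbf{K}$. Then the isomorphism relation $\{(A,B) \in \mathbf{K}\times\mathbf{K} : A \cong B\}$ is a Borel subset of $\mathbf{K}\times\mathbf{K}$. In particular, $\mathbf{K}$ is not Borel complete, where $\mathbf{K}$ is called Borel complete if there is a Borel map $f$ from the space of graphs with domain $\omega$ (irreflexive symmetric binary relations on $\omega$, as a subspace of $\{0,1\}^{\omega\times\omega}$) to $\mathbf{K}$ such that for all graphs $A, B$ with domain $\omega$ we have $A \cong B$ if and only if $f(A) \cong f(B)$. -/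

import Mathlib

universe u v

namespace CountableModels

/-- The coding of an `L`-structure with domain `ℕ` as a point of the product, over the symbols
of `L`, of the spaces of operations `ℕⁿ → ℕ` and of (characteristic functions of) relations
on `ℕⁿ`. -/
noncomputable def code (L : FirstOrder.Language.{u, v}) (A : L.Structure ℕ) :
    (∀ f : (Σ n, L.Functions n), (Fin f.1 → ℕ) → ℕ) ×
      (∀ r : (Σ n, L.Relations n), (Fin r.1 → ℕ) → Bool) :=
  (fun f x => A.funMap f.2 x, fun r x => @decide (A.RelMap r.2 x) (Classical.propDecidable _))

/-- The usual topology on the space of `L`-structures with domain `ℕ`: the product topology,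
where `ℕ` and `Bool` are discrete. -/
noncomputable instance structureTopology (L : FirstOrder.Language.{u, v}) :
    TopologicalSpace (L.Structure ℕ) :=
  TopologicalSpace.induced (code L) inferInstance

/-- The Borel `σ`-algebra of the space of `L`-structures with domain `ℕ`. -/
noncomputable instance structureMeasurableSpace (L : FirstOrder.Language.{u, v}) :
    MeasurableSpace (L.Structure ℕ) :=
  borel (L.Structure ℕ)

instance structureBorelSpace (L : FirstOrder.Language.{u, v}) : BorelSpace (L.Structure ℕ) := ⟨rfl⟩

/-- The isomorphisms between two `L`-structures with domain `ℕ`. -/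
abbrev Iso {L : FirstOrder.Language.{u, v}} (A B : L.Structure ℕ) :=
  @FirstOrder.Language.Equiv L ℕ ℕ A B

/-- The (underlying set of the) automorphism group of an `L`-structure with domain `ℕ`. -/
abbrev Aut {L : FirstOrder.Language.{u, v}} (A : L.Structure ℕ) := Iso A A

/-- The isomorphism relation on a class `K` of `L`-structures with domain `ℕ`, as a subset of
`K × K`. -/
def isoRel {L : FirstOrder.Language.{u, v}} (K : Set (L.Structure ℕ)) : Set (K × K) :=
  {p | Nonempty (Iso (p.1 : L.Structure ℕ) (p.2 : L.Structure ℕ))}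

/-- The graphs (irreflexive symmetric relations) with domain `ℕ`, as a subspace of the space of
structures in the language with one binary relation symbol. -/
def graphs : Set (FirstOrder.Language.graph.Structure ℕ) :=
  {A | @FirstOrder.Language.Theory.Model FirstOrder.Language.graph ℕ A
    FirstOrder.Language.Theory.simpleGraph}

/-- `K` is Borel complete: there is a Borel map from the space of graphs with domain `ℕ` to `K`
that reduces isomorphism of graphs to isomorphism on `K`. -/
def BorelComplete {L : FirstOrder.Language.{u, v}} (K : Set (L.Structure ℕ)) : Prop :=
  ∃ f : graphs → K, Measurable f ∧ ∀ A B : graphs, (A, B) ∈ isoRel graphs ↔ (f A, f B) ∈ isoRel K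

end CountableModels

/-! Borelness. By Baire category, a countable automorphism group has trivial pointwise stabiliser
over some `0, …, n - 1` (`exists_mem_rigidOver`). Inside `K`, rigidity over these points is a
coanalytic condition, and Novikov's theorem (`jointlySeparable_of_analyticSet`) shrinks the
resulting sets to Borel sets `C n` that still cover `K`. An isomorphism from a structure in `C n` to
a given structure is determined by its values below `n`, so the isomorphism relation is a countable
union of injective projections of Borel sets, and these are Borel by Lusin–Souslin.

Borel completeness would pull this Borel relation back to isomorphism of graphs, so it suffices that
the latter is not Borel. Every Borel subset of Cantor space reduces continuously to isomorphism with
a fixed labelled tree (`treeReducible_of_measurableSet`), and labelled trees are coded by graphs. If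
isomorphism of graphs were Borel, so would be the set of `c` such that two graphs, coded by `c` and
evaluated at `c` itself, are isomorphic. A `c` that codes a reduction of the complement of this set
is contradictory (`not_measurableSet_isoRel_graphs`). -/

open Set MeasureTheory

namespace CountableModels

/-! ### Novikov's separation theorem for analytic sets -/

section Novikov

variable {α : Type*}

/-- A sequence of sets that can be covered, term by term, by measurable sets with empty
intersection. -/
def JointlySeparable [MeasurableSpace α] (B : ℕ → Set α) : Prop :=
  ∃ E : ℕ → Set α, (∀ n, MeasurableSet (E n)) ∧ (∀ n, B n ⊆ E n) ∧ ⋂ n, E n = ∅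

/-- Unite the separating sets at index `i` and intersect them elsewhere. Contrapositively,
inseparability survives in some piece when one of the sets is split countably. -/
theorem JointlySeparable.of_cover [MeasurableSpace α] {B : ℕ → Set α} {C : ℕ → ℕ → Set α} (i : ℕ)
    (hi : B i ⊆ ⋃ j, C j i) (hne : ∀ k ≠ i, ∀ j, B k ⊆ C j k)
    (h : ∀ j, JointlySeparable (C j)) : JointlySeparable B := by
  choose E hm hs he using h
  refine ⟨fun k => if k = i then ⋃ j, E j k else ⋂ j, E j k, fun k => ?_, fun k => ?_, ?_⟩
  · dsimp only
    split_ifs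
    · exact MeasurableSet.iUnion fun j => hm j k
    · exact MeasurableSet.iInter fun j => hm j k
  · dsimp only
    split_ifs with hk
    · subst hk
      exact hi.trans (iUnion_mono fun j => hs j k)
    · exact subset_iInter fun j => (hne k hk j).trans (hs j k)
  · refine eq_empty_of_forall_notMem fun z hz => ?_
    rw [mem_iInter] at hz
    have hz' := hz i
    simp only [if_true, mem_iUnion] at hz'
    obtain ⟨j, hj⟩ := hz'
    have : z ∈ ⋂ n, E j n := by
      rw [mem_iInter]
      intro k
      by_cases hk : k = i
      · rwa [hk]
      · have := hz k
        rw [if_neg hk, mem_iInter] at this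
        exact this j
    rw [he j] at this
    exact this

/-- The image under `f i` of the points whose coordinates agree with the first `k` entries of `y`,
where `y` codes a sequence of points of the Baire space. -/
def stageImage (f : ℕ → (ℕ → ℕ) → α) (y : ℕ → ℕ) (k i : ℕ) : Set α :=
  f i '' {x | ∀ m, Nat.pair i m < k → x m = y (Nat.pair i m)}

theorem stageImage_congr (f : ℕ → (ℕ → ℕ) → α) {y y' : ℕ → ℕ} {k : ℕ}
    (h : ∀ m < k, y m = y' m) : stageImage f y k = stageImage f y' k := by
  funext i
  unfold stageImage
  congr 1
  ext x
  exact forall_congr' fun m => forall_congr' fun hm => by rw [h _ hm]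

theorem exists_update_not_jointlySeparable [MeasurableSpace α] (f : ℕ → (ℕ → ℕ) → α)
    (y : ℕ → ℕ) (k : ℕ) (h : ¬ JointlySeparable (stageImage f y k)) :
    ∃ j, ¬ JointlySeparable (stageImage f (Function.update y k j) (k + 1)) := by
  by_contra! hc
  -- Entry `k` of `y` is a coordinate of the point with index `(Nat.unpair k).1`, so fixing it
  -- splits only that set.
  refine h (JointlySeparable.of_cover (Nat.unpair k).1 ?_ ?_ hc)
  · rintro _ ⟨x, hx, rfl⟩
    refine mem_iUnion.2 ⟨x (Nat.unpair k).2, x, fun m hm => ?_, rfl⟩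
    rcases Nat.lt_succ_iff_lt_or_eq.1 hm with hlt | heq
    · rw [Function.update_of_ne hlt.ne]
      exact hx m hlt
    · have : m = (Nat.unpair k).2 := by rw [← heq, Nat.unpair_pair]
      rw [heq, Function.update_self, this]
  · rintro i hi j _ ⟨x, hx, rfl⟩
    refine ⟨x, fun m hm => ?_, rfl⟩
    rcases Nat.lt_succ_iff_lt_or_eq.1 hm with hlt | heq
    · rw [Function.update_of_ne hlt.ne]
      exact hx m hlt
    · exact absurd (by rw [← heq, Nat.unpair_pair]) hi

theorem exists_branch_not_jointlySeparable [MeasurableSpace α] (f : ℕ → (ℕ → ℕ) → α)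
    (h : ¬ JointlySeparable (fun i => range (f i))) :
    ∃ y, ∀ k, ¬ JointlySeparable (stageImage f y k) := by
  have h0 : ¬ JointlySeparable (stageImage f 0 0) := by
    convert h using 2
    funext i
    simp [stageImage]
  choose! nxt hnxt using exists_update_not_jointlySeparable f
  let s : ℕ → ℕ → ℕ := fun k => Nat.rec 0 (fun k y => Function.update y k (nxt y k)) k
  have hsucc : ∀ k, s (k + 1) = Function.update (s k) k (nxt (s k) k) := fun k => rfl
  have hs : ∀ k, ¬ JointlySeparable (stageImage f (s k) k) := by
    intro k
    induction k with
    | zero => exact h0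
    | succ k ih => exact hnxt _ _ ih
  have hstab : ∀ k m, m < k → s k m = s (m + 1) m := by
    intro k
    induction k with
    | zero => intro m hm; omega
    | succ k ih =>
      intro m hm
      rcases Nat.lt_succ_iff_lt_or_eq.1 hm with hlt | heq
      · rw [hsucc, Function.update_of_ne hlt.ne, ih m hlt]
      · rw [heq]
  refine ⟨fun m => s (m + 1) m, fun k => ?_⟩
  rw [← stageImage_congr f (hstab k)]
  exact hs k

theorem exists_stageImage_subset [TopologicalSpace α] {f : ℕ → (ℕ → ℕ) → α}
    (hf : ∀ i, Continuous (f i)) (y : ℕ → ℕ) (i : ℕ) {U : Set α} (hU : IsOpen U)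
    (hy : f i (fun m => y (Nat.pair i m)) ∈ U) : ∃ k₀, ∀ k ≥ k₀, stageImage f y k i ⊆ U := by
  obtain ⟨V, ⟨x, n, rfl⟩, hxV, hVU⟩ :=
    (PiNat.isTopologicalBasis_cylinders fun _ => ℕ).exists_subset_of_mem_open
      (show (fun m => y (Nat.pair i m)) ∈ f i ⁻¹' U from hy) (hU.preimage (hf i))
  -- By monotonicity of pairing, the first `n` coordinates of point `i` are all fixed by this stage.
  refine ⟨Nat.pair i n, ?_⟩
  rintro k hk _ ⟨x', hx', rfl⟩
  refine hVU fun m hm => ?_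
  rw [hx' m ((Nat.pair_lt_pair_right i hm).trans_le hk)]
  exact hxV m hm

/-- **Novikov's separation theorem**: a sequence of analytic sets with empty intersection can be
covered, term by term, by Borel sets with empty intersection. -/
theorem jointlySeparable_of_analyticSet [TopologicalSpace α] [T2Space α] [MeasurableSpace α]
    [OpensMeasurableSpace α] {A : ℕ → Set α} (hA : ∀ n, AnalyticSet (A n)) (he : ⋂ n, A n = ∅) :
    JointlySeparable A := by
  by_cases hemp : ∃ n, A n = ∅
  · obtain ⟨n, hn⟩ := hemp
    refine ⟨fun k => if k = n then ∅ else univ, fun k => ?_, fun k => ?_, ?_⟩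
    · dsimp only
      split_ifs <;> simp
    · dsimp only
      split_ifs with hk
      · rw [hk, hn]
      · exact subset_univ _
    · refine eq_empty_of_forall_notMem fun z hz => ?_
      simpa using mem_iInter.1 hz n
  push Not at hemp
  have hA' : ∀ n, ∃ f : (ℕ → ℕ) → α, Continuous f ∧ range f = A n := fun n => by
    have := hA n
    rw [AnalyticSet] at this
    exact this.resolve_left (hemp n).ne_empty
  choose f hf hr using hA'
  by_contra hns
  obtain ⟨y, hy⟩ := exists_branch_not_jointlySeparable f (by
    rwa [show (fun i => range (f i)) = A from funext hr])
  -- If the branch gave the same value under all `f i`, that value would lie in every `A n`. Two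
  -- distinct values have disjoint open neighbourhoods, which separate a late stage.
  have hneq : ∃ i, f i (fun m => y (Nat.pair i m)) ≠ f 0 (fun m => y (Nat.pair 0 m)) := by
    by_contra! hc
    have : f 0 (fun m => y (Nat.pair 0 m)) ∈ ⋂ n, A n := by
      refine mem_iInter.2 fun n => ?_
      rw [← hc n, ← hr n]
      exact mem_range_self _
    rw [he] at this
    exact this
  obtain ⟨i, hi⟩ := hneq
  have hi0 : i ≠ 0 := by
    rintro rfl
    exact hi rfl
  obtain ⟨U, V, hU, hV, hxU, hxV, hd⟩ := t2_separation hi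
  obtain ⟨k₁, h₁⟩ := exists_stageImage_subset hf y i hU hxU
  obtain ⟨k₂, h₂⟩ := exists_stageImage_subset hf y 0 hV hxV
  refine hy (max k₁ k₂) ⟨fun k => if k = i then U else if k = 0 then V else univ,
    fun k => ?_, fun k => ?_, ?_⟩
  · dsimp only
    split_ifs
    exacts [hU.measurableSet, hV.measurableSet, MeasurableSet.univ]
  · dsimp only
    split_ifs with h h'
    · rw [h]
      exact h₁ _ (le_max_left _ _)
    · rw [h']
      exact h₂ _ (le_max_right _ _)
    · exact subset_univ _
  · refine eq_empty_of_forall_notMem fun z hz => ?_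
    rw [mem_iInter] at hz
    have hzU := hz i
    have hzV := hz 0
    simp only [if_true, if_neg hi0.symm] at hzU hzV
    exact disjoint_left.1 hd hzU hzV

end Novikov

/-! ### The Polish space of structures and its Borel sets -/

section StructureSpace

variable {L : FirstOrder.Language.{u, v}}

/-- Structures with domain `ℕ` correspond bijectively to their codes. -/
noncomputable def codeEquiv (L : FirstOrder.Language.{u, v}) :
    L.Structure ℕ ≃ (∀ f : (Σ n, L.Functions n), (Fin f.1 → ℕ) → ℕ) ×
      (∀ r : (Σ n, L.Relations n), (Fin r.1 → ℕ) → Bool) where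
  toFun := code L
  invFun c := ⟨fun {n} f x => c.1 ⟨n, f⟩ x, fun {n} r x => c.2 ⟨n, r⟩ x = true⟩
  left_inv A := by
    ext
    · rfl
    · exact @decide_eq_true_iff _ (Classical.propDecidable _)
  right_inv c := by
    refine Prod.ext rfl (funext fun r => funext fun x => ?_)
    exact Bool.decide_eq_true

theorem continuous_code : Continuous (code L) := continuous_induced_dom

theorem continuous_funMap (f : Σ n, L.Functions n) (x : Fin f.1 → ℕ) :
    Continuous fun A : L.Structure ℕ => A.funMap f.2 x :=
  (continuous_apply x).comp ((continuous_apply f).comp (continuous_fst.comp continuous_code))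

theorem isClopen_relMap (r : Σ n, L.Relations n) (x : Fin r.1 → ℕ) :
    IsClopen {A : L.Structure ℕ | A.RelMap r.2 x} := by
  have h : Continuous fun A : L.Structure ℕ => (code L A).2 r x :=
    (continuous_apply x).comp ((continuous_apply r).comp (continuous_snd.comp continuous_code))
  have : {A : L.Structure ℕ | A.RelMap r.2 x} = (fun A => (code L A).2 r x) ⁻¹' {true} := by
    ext A
    simp [code]
  rw [this]
  exact (isClopen_discrete _).preimage h

variable [Countable L.Symbols]

instance countable_sigma_relations : Countable (Σ n, L.Relations n) :=
  Function.Injective.countable (f := (Sum.inr : _ → L.Symbols)) Sum.inr_injective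

instance polishSpace_structure : PolishSpace (L.Structure ℕ) := by
  have : PolishSpace ((∀ f : (Σ n, L.Functions n), (Fin f.1 → ℕ) → ℕ) ×
    (∀ r : (Σ n, L.Relations n), (Fin r.1 → ℕ) → Bool)) :=
    { toSecondCountableTopology := inferInstance, toIsCompletelyMetrizableSpace := inferInstance }
  exact (codeEquiv L).polishSpace_induced

theorem measurable_structure_iff {Z : Type*} [MeasurableSpace Z] {F : Z → L.Structure ℕ} :
    Measurable F ↔ (∀ (f : Σ n, L.Functions n) x, Measurable fun z => (F z).funMap f.2 x) ∧
      ∀ (r : Σ n, L.Relations n) x, MeasurableSet {z | (F z).RelMap r.2 x} := by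
  refine ⟨fun h => ⟨fun f x => (continuous_funMap f x).measurable.comp h,
    fun r x => h (isClopen_relMap r x).isOpen.measurableSet⟩, fun ⟨hf, hr⟩ => ?_⟩
  -- The product has countably many second countable factors, so its Borel `σ`-algebra is the
  -- product one.
  have hm : structureMeasurableSpace L = MeasurableSpace.comap (code L) inferInstance := by
    refine (borel_comap (f := code L)).trans ?_
    congr 1
    exact (BorelSpace.measurable_eq (α := (∀ f : (Σ n, L.Functions n), (Fin f.1 → ℕ) → ℕ) ×
      (∀ r : (Σ n, L.Relations n), (Fin r.1 → ℕ) → Bool))).symm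
  rw [hm, measurable_comap_iff]
  refine Measurable.prodMk ?_ ?_
  · refine measurable_pi_lambda _ fun f => measurable_pi_lambda _ fun x => hf f x
  · refine measurable_pi_lambda _ fun r => measurable_pi_lambda _ fun x => measurable_to_bool ?_
    convert hr r x using 1
    ext z
    simp

end StructureSpace

/-! ### Borelness of isomorphism when automorphism groups are countable -/

section Isomorphism

variable {L : FirstOrder.Language.{u, v}}

/-- `p = (A, B, g, h)` where `g` is an isomorphism from `A` to `B` with inverse `h`. -/
def isoSet (L : FirstOrder.Language.{u, v}) :
    Set ((L.Structure ℕ × L.Structure ℕ) × ((ℕ → ℕ) × (ℕ → ℕ))) :=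
  {p | (∀ i, p.2.1 (p.2.2 i) = i ∧ p.2.2 (p.2.1 i) = i) ∧
    (∀ (f : Σ n, L.Functions n) x, p.2.1 (p.1.1.funMap f.2 x) = p.1.2.funMap f.2 (p.2.1 ∘ x)) ∧
    ∀ (r : Σ n, L.Relations n) x, p.1.2.RelMap r.2 (p.2.1 ∘ x) ↔ p.1.1.RelMap r.2 x}

/-- The isomorphism given by a point of `isoSet`. -/
def isoOfMem {A B : L.Structure ℕ} {g h : ℕ → ℕ} (H : ((A, B), (g, h)) ∈ isoSet L) : Iso A B :=
  @FirstOrder.Language.Equiv.mk L ℕ ℕ A B ⟨g, h, fun i => (H.1 i).2, fun i => (H.1 i).1⟩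
    (fun f x => H.2.1 ⟨_, f⟩ x) (fun r x => H.2.2 ⟨_, r⟩ x)

theorem mem_isoSet_of_iso {A B : L.Structure ℕ} (e : Iso A B) :
    ((A, B), ((@FirstOrder.Language.Equiv.toEquiv L ℕ ℕ A B e).toFun, (@FirstOrder.Language.Equiv.toEquiv L ℕ ℕ A B e).invFun)) ∈ isoSet L :=
  ⟨fun i => ⟨(@FirstOrder.Language.Equiv.toEquiv L ℕ ℕ A B e).right_inv i, (@FirstOrder.Language.Equiv.toEquiv L ℕ ℕ A B e).left_inv i⟩,
    fun f x => @FirstOrder.Language.Equiv.map_fun' L ℕ ℕ A B e _ f.2 x,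
    fun r x => @FirstOrder.Language.Equiv.map_rel' L ℕ ℕ A B e _ r.2 x⟩

theorem nonempty_iso_iff {A B : L.Structure ℕ} :
    Nonempty (Iso A B) ↔ ∃ q, ((A, B), q) ∈ isoSet L :=
  ⟨fun ⟨e⟩ => ⟨_, mem_isoSet_of_iso e⟩, fun ⟨_, H⟩ => ⟨isoOfMem H⟩⟩

theorem isoSet_comp {A B C : L.Structure ℕ} {q q' : (ℕ → ℕ) × (ℕ → ℕ)}
    (H : ((A, B), q) ∈ isoSet L) (H' : ((B, C), q') ∈ isoSet L) :
    ((A, C), (q'.1 ∘ q.1, q.2 ∘ q'.2)) ∈ isoSet L := by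
  obtain ⟨h1, h2, h3⟩ := H
  obtain ⟨h1', h2', h3'⟩ := H'
  dsimp only at *
  refine ⟨fun i => ⟨?_, ?_⟩, fun f x => ?_, fun r x => ?_⟩
  · simp [(h1 _).1, (h1' _).1]
  · simp [(h1 _).2, (h1' _).2]
  · simp only [Function.comp_apply, h2, h2', Function.comp_assoc]
  · rw [← h3, ← h3', Function.comp_assoc]

theorem isoSet_symm {A B : L.Structure ℕ} {q : (ℕ → ℕ) × (ℕ → ℕ)}
    (H : ((A, B), q) ∈ isoSet L) : ((B, A), q.swap) ∈ isoSet L := by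
  obtain ⟨h1, h2, h3⟩ := H
  dsimp only at *
  have hc : ∀ {n} (x : Fin n → ℕ), q.1 ∘ q.2 ∘ x = x := fun x => funext fun i => (h1 (x i)).1
  refine ⟨fun i => ⟨(h1 i).2, (h1 i).1⟩, fun f x => ?_, fun r x => ?_⟩
  · have := h2 f (q.2 ∘ x)
    rw [hc] at this
    dsimp only [Prod.fst_swap, Prod.snd_swap]
    rw [← this, (h1 _).2]
  · have := h3 r (q.2 ∘ x)
    rw [hc] at this
    exact this.symm

theorem isoSet_snd_inj {A B : L.Structure ℕ} {g h h' : ℕ → ℕ}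
    (H : ((A, B), (g, h)) ∈ isoSet L) (H' : ((A, B), (g, h')) ∈ isoSet L) : h = h' := by
  funext i
  have h1 := (H.1 i).1
  have h2 := (H'.1 (h i)).2
  dsimp only at h1 h2
  rw [h1] at h2
  exact h2.symm

theorem measurable_eval_left {S : Type*} [MeasurableSpace S] {p : S → ℕ → ℕ} (hp : Measurable p)
    {k : S → ℕ} (hk : Measurable k) : Measurable fun s => p s (k s) := by
  have : Measurable fun q : (ℕ → ℕ) × ℕ => q.1 q.2 :=
    measurable_from_prod_countable_left fun n => measurable_pi_apply n
  exact this.comp (hp.prodMk hk)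

theorem measurableSet_isoSet [Countable L.Symbols] : MeasurableSet (isoSet L) := by
  have hg : Measurable fun p : (L.Structure ℕ × L.Structure ℕ) × ((ℕ → ℕ) × (ℕ → ℕ)) => p.2.1 :=
    measurable_fst.comp measurable_snd
  have hh : Measurable fun p : (L.Structure ℕ × L.Structure ℕ) × ((ℕ → ℕ) × (ℕ → ℕ)) => p.2.2 :=
    measurable_snd.comp measurable_snd
  have hA : Measurable fun p : (L.Structure ℕ × L.Structure ℕ) × ((ℕ → ℕ) × (ℕ → ℕ)) => p.1.1 :=
    measurable_fst.comp measurable_fst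
  have hB : Measurable fun p : (L.Structure ℕ × L.Structure ℕ) × ((ℕ → ℕ) × (ℕ → ℕ)) => p.1.2 :=
    measurable_snd.comp measurable_fst
  have hgx : ∀ {n} (x : Fin n → ℕ), Measurable fun
      p : (L.Structure ℕ × L.Structure ℕ) × ((ℕ → ℕ) × (ℕ → ℕ)) => p.2.1 ∘ x := fun x =>
    measurable_pi_lambda _ fun i => (measurable_pi_apply (x i)).comp hg
  have hfB : ∀ (f : Σ n, L.Functions n), Measurable fun q : L.Structure ℕ × (Fin f.1 → ℕ) =>
      q.1.funMap f.2 q.2 := fun f =>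
    measurable_from_prod_countable_left fun x => (continuous_funMap f x).measurable
  have hrB : ∀ (r : Σ n, L.Relations n), MeasurableSet {q : L.Structure ℕ × (Fin r.1 → ℕ) |
      q.1.RelMap r.2 q.2} := fun r =>
    measurableSet_setOfPred.2 (measurable_from_prod_countable_left fun x =>
      measurableSet_setOfPred.1 (isClopen_relMap r x).isOpen.measurableSet)
  simp only [isoSet, ofPred_and, ofPred_forall]
  refine MeasurableSet.inter ?_ (MeasurableSet.inter ?_ ?_)
  · refine MeasurableSet.iInter fun i => MeasurableSet.inter ?_ ?_
    · exact measurableSet_eq_fun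
        (measurable_eval_left hg ((measurable_pi_apply i).comp hh)) measurable_const
    · exact measurableSet_eq_fun
        (measurable_eval_left hh ((measurable_pi_apply i).comp hg)) measurable_const
  · refine MeasurableSet.iInter fun f => MeasurableSet.iInter fun x => ?_
    exact measurableSet_eq_fun
      (measurable_eval_left hg ((continuous_funMap f x).measurable.comp hA))
      ((hfB f).comp (hB.prodMk (hgx x)))
  · refine MeasurableSet.iInter fun r => MeasurableSet.iInter fun x => ?_
    exact measurableSet_setOfPred.2 <| Measurable.iff
      (measurableSet_setOfPred.1 ((hB.prodMk (hgx x)) (hrB r)))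
      (measurableSet_setOfPred.1 (hA (isClopen_relMap r x).isOpen.measurableSet))

/-- The structures with no nontrivial automorphism fixing `0, …, n - 1`. -/
def rigidOver (L : FirstOrder.Language.{u, v}) (n : ℕ) : Set (L.Structure ℕ) :=
  {A | ∀ q, ((A, A), q) ∈ isoSet L → (∀ i < n, q.1 i = i) → q.1 = id}

/-- Recording the inverse next to the map makes bijectivity a closed condition, so the automorphisms
form a Polish space. -/
theorem isClosed_automorphisms (A : L.Structure ℕ) : IsClosed {q | ((A, A), q) ∈ isoSet L} := by
  have hev : ∀ {S : Type} [TopologicalSpace S] {p : S → ℕ → ℕ} {k : S → ℕ}, Continuous p →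
      Continuous k → Continuous fun s => p s (k s) := by
    intro S _ p k hp hk
    refine continuous_iff_continuousAt.2 fun s => ?_
    have h1 : ∀ᶠ t in nhds s, k t = k s := hk.continuousAt.eventually_mem
      ((isOpen_discrete {k s}).mem_nhds rfl)
    refine ((continuous_apply (k s)).comp hp).continuousAt.congr ?_
    filter_upwards [h1] with t ht
    simp [ht]
  have hg : Continuous fun q : (ℕ → ℕ) × (ℕ → ℕ) => q.1 := continuous_fst
  have hgx : ∀ {n} (x : Fin n → ℕ), Continuous fun q : (ℕ → ℕ) × (ℕ → ℕ) => q.1 ∘ x := fun x =>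
    continuous_pi fun i => (continuous_apply (x i)).comp hg
  simp only [isoSet, ofPred_and, ofPred_forall, mem_inter_iff, mem_iInter, mem_ofPred_eq]
  refine IsClosed.inter ?_ (IsClosed.inter ?_ ?_)
  · refine isClosed_iInter fun i => IsClosed.inter ?_ ?_
    · exact isClosed_eq (hev continuous_fst ((continuous_apply i).comp continuous_snd))
        continuous_const
    · exact isClosed_eq (hev continuous_snd ((continuous_apply i).comp continuous_fst))
        continuous_const
  · refine isClosed_iInter fun f => isClosed_iInter fun x => ?_
    exact isClosed_eq ((continuous_apply (A.funMap f.2 x)).comp hg)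
      ((continuous_of_discreteTopology (f := A.funMap f.2)).comp (hgx x))
  · refine isClosed_iInter fun r => isClosed_iInter fun x => ?_
    exact (isClosed_discrete {y | A.RelMap r.2 y ↔ A.RelMap r.2 x}).preimage (hgx x)

/-- A nonempty countable Polish space has an isolated point `q`. An automorphism `k` fixing enough
points leaves `q ∘ k` in the isolating neighbourhood, whence `q ∘ k = q` and `k = id`. -/
theorem exists_mem_rigidOver {A : L.Structure ℕ} (hA : Countable (Aut A)) :
    ∃ n, A ∈ rigidOver L n := by
  let X := {q | ((A, A), q) ∈ isoSet L}
  have : PolishSpace X := (isClosed_automorphisms A).polishSpace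
  have : Countable X := Function.Injective.countable
    (f := fun q : X => (isoOfMem q.2 : Aut A)) fun q q' h => by
      have h1 : (isoOfMem q.2).toEquiv = (isoOfMem q'.2).toEquiv := congrArg (·.toEquiv) h
      exact Subtype.ext (Prod.ext (congrArg Equiv.toFun h1) (congrArg Equiv.invFun h1))
  have hid : ((A, A), (id, id)) ∈ isoSet L := ⟨fun i => ⟨rfl, rfl⟩, fun f x => rfl, fun r x => Iff.rfl⟩
  have : Nonempty X := ⟨⟨_, hid⟩⟩
  obtain ⟨q, hq⟩ := nonempty_interior_of_iUnion_of_closed (f := fun q : X => {q})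
    (fun q => isClosed_singleton) (iUnion_of_singleton X)
  have hopen : IsOpen ({q} : Set X) := by
    rw [← (subset_singleton_iff_eq.1 interior_subset).resolve_left hq.ne_empty]
    exact isOpen_interior
  obtain ⟨U, hU, hUq⟩ := isOpen_induced_iff.1 hopen
  have hqU : q.1 ∈ U := by
    have : q ∈ Subtype.val ⁻¹' U := hUq ▸ mem_singleton q
    exact this
  obtain ⟨V, W, hV, hW, hqV, hqW, hVW⟩ := isOpen_prod_iff.1 hU q.1.1 q.1.2 hqU
  obtain ⟨_, ⟨x, n, rfl⟩, hx, hxV⟩ :=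
    (PiNat.isTopologicalBasis_cylinders fun _ => ℕ).exists_subset_of_mem_open hqV hV
  obtain ⟨_, ⟨y, m, rfl⟩, hy, hyW⟩ :=
    (PiNat.isTopologicalBasis_cylinders fun _ => ℕ).exists_subset_of_mem_open hqW hW
  -- The neighbourhood also restricts the inverse of `q ∘ k`, so `k` must fix the values of `q⁻¹`
  -- below `m`.
  obtain ⟨N, hN⟩ : ∃ N, ∀ i < m, q.1.2 i < N :=
    ⟨(Finset.range m).sup q.1.2 + 1, fun i hi =>
      Nat.lt_succ_of_le (Finset.le_sup (Finset.mem_range.2 hi))⟩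
  refine ⟨max n N, fun k hk hfix => ?_⟩
  have hfix' : ∀ i < max n N, k.2 i = i := fun i hi => by
    conv_lhs => rw [← hfix i hi]
    exact (hk.1 i).2
  have hmem := isoSet_comp hk q.2
  have hin : (q.1.1 ∘ k.1, k.2 ∘ q.1.2) ∈ U := by
    refine hVW ⟨hxV fun i hi => ?_, hyW fun i hi => ?_⟩
    · show q.1.1 (k.1 i) = x i
      rw [hfix i (hi.trans_le (le_max_left _ _))]
      exact hx i hi
    · show k.2 (q.1.2 i) = y i
      rw [hfix' _ ((hN i hi).trans_le (le_max_right _ _))]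
      exact hy i hi
  have heq : (⟨_, hmem⟩ : X) ∈ ({q} : Set X) := hUq ▸ hin
  have h1 : q.1.1 ∘ k.1 = q.1.1 := congrArg Prod.fst (congrArg Subtype.val heq)
  funext i
  have h2 := congrArg q.1.2 (congrFun h1 i)
  have h3 := fun j => (q.2.1 j).2
  dsimp only at h3
  rwa [Function.comp_apply, h3, h3] at h2

variable [Countable L.Symbols]

/-- The sets `K \ rigidOver L n` are projections of Borel sets and have empty intersection; the
complements in `K` of Novikov's separating sets are the cover. -/
theorem exists_measurable_cover_rigidOver {K : Set (L.Structure ℕ)} (hK : MeasurableSet K)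
    (hAut : ∀ A ∈ K, Countable (Aut A)) :
    ∃ C : ℕ → Set (L.Structure ℕ), (∀ n, MeasurableSet (C n)) ∧ (∀ n, C n ⊆ rigidOver L n) ∧
      K = ⋃ n, C n := by
  have hD : ∀ n, AnalyticSet (K \ rigidOver L n) := fun n => by
    have hm : MeasurableSet {p : L.Structure ℕ × ((ℕ → ℕ) × (ℕ → ℕ)) | p.1 ∈ K ∧
        ((p.1, p.1), p.2) ∈ isoSet L ∧ (∀ i < n, p.2.1 i = i) ∧ p.2.1 ≠ id} := by
      have hg : Measurable fun p : L.Structure ℕ × ((ℕ → ℕ) × (ℕ → ℕ)) => p.2.1 :=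
        measurable_fst.comp measurable_snd
      simp only [ofPred_and, ofPred_forall]
      refine (measurable_fst hK).inter (MeasurableSet.inter ?_ (MeasurableSet.inter ?_ ?_))
      · exact ((measurable_fst.prodMk measurable_fst).prodMk measurable_snd) measurableSet_isoSet
      · exact MeasurableSet.iInter fun i => MeasurableSet.iInter fun _ =>
          measurableSet_eq_fun ((measurable_pi_apply i).comp hg) measurable_const
      · exact (measurableSet_eq_fun hg measurable_const).compl
    convert hm.analyticSet_image measurable_fst using 1
    ext A
    simp only [rigidOver, mem_sdiff, mem_ofPred_eq, not_forall, mem_image, exists_prop]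
    constructor
    · rintro ⟨hA, q, hq, hfix, hne⟩
      exact ⟨(A, q), ⟨hA, hq, hfix, hne⟩, rfl⟩
    · rintro ⟨⟨_, q⟩, ⟨hA, hq, hfix, hne⟩, rfl⟩
      exact ⟨hA, q, hq, hfix, hne⟩
  obtain ⟨E, hE, hDE, he⟩ := jointlySeparable_of_analyticSet hD (by
    refine eq_empty_of_forall_notMem fun A hA => ?_
    rw [mem_iInter] at hA
    obtain ⟨n, hn⟩ := exists_mem_rigidOver (hAut A (hA 0).1)
    exact (hA n).2 hn)
  refine ⟨fun n => K \ E n, fun n => hK.diff (hE n), fun n A hA => ?_, ?_⟩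
  · by_contra hc
    exact hA.2 (hDE n ⟨hA.1, hc⟩)
  · rw [← sdiff_iInter, he, sdiff_empty]

theorem measurableSet_isoRel {K : Set (L.Structure ℕ)} (hK : MeasurableSet K)
    (hAut : ∀ A ∈ K, Countable (Aut A)) : MeasurableSet (isoRel K) := by
  obtain ⟨C, hC, hCr, hKC⟩ := exists_measurable_cover_rigidOver hK hAut
  let P : (Σ n, Fin n → ℕ) → Set ((L.Structure ℕ × L.Structure ℕ) × ((ℕ → ℕ) × (ℕ → ℕ))) :=
    fun b => {p | p.1.1 ∈ C b.1 ∧ p ∈ isoSet L ∧ ∀ i : Fin b.1, p.2.1 i = b.2 i}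
  have hP : ∀ b, MeasurableSet (P b) := fun b => by
    simp only [P, ofPred_and, ofPred_forall]
    refine ((measurable_fst.comp measurable_fst) (hC b.1)).inter
      (measurableSet_isoSet.inter ?_)
    exact MeasurableSet.iInter fun i => measurableSet_eq_fun
      ((measurable_pi_apply (i : ℕ)).comp (measurable_fst.comp measurable_snd)) measurable_const
  have hinj : ∀ b, InjOn Prod.fst (P b) := by
    rintro ⟨n, b⟩ ⟨⟨A, B⟩, ⟨g, h⟩⟩ ⟨hA, hq, hb⟩ ⟨⟨A', B'⟩, ⟨g', h'⟩⟩ ⟨_, hq', hb'⟩ heq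
    obtain ⟨rfl, rfl⟩ := Prod.mk.inj heq
    have hg : g = g' := by
      -- Two isomorphisms with the same values below `n` differ by an automorphism of `A` fixing
      -- these points.
      have hid := hCr n hA _ (isoSet_comp hq (isoSet_symm hq')) fun i hi => by
        have h1 := hb ⟨i, hi⟩
        have h2 := hb' ⟨i, hi⟩
        dsimp only [Prod.fst_swap, Function.comp_apply] at h1 h2 ⊢
        rw [h1, ← h2]
        exact (hq'.1 i).2
      funext i
      have h1 := congrArg g' (congrFun hid i)
      have h2 := (hq'.1 (g i)).1
      dsimp only [Prod.fst_swap, Function.comp_apply, id] at h1 h2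
      rwa [h2] at h1
    subst hg
    rw [isoSet_snd_inj hq hq']
  have himg : MeasurableSet (⋃ b, Prod.fst '' P b) :=
    MeasurableSet.iUnion fun b => (hP b).image_of_measurable_injOn measurable_fst (hinj b)
  convert ((measurable_subtype_coe.comp measurable_fst).prodMk
    (measurable_subtype_coe.comp measurable_snd) : Measurable fun p : K × K =>
      ((p.1 : L.Structure ℕ), (p.2 : L.Structure ℕ))) himg using 1
  ext ⟨A, B⟩
  simp only [isoRel, mem_ofPred_eq, nonempty_iso_iff, mem_preimage, mem_iUnion, mem_image]
  constructor
  · rintro ⟨q, hq⟩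
    obtain ⟨n, hn⟩ := mem_iUnion.1 (hKC.subset A.2)
    exact ⟨⟨n, fun i => q.1 i⟩, (_, q), ⟨hn, hq, fun i => rfl⟩, rfl⟩
  · rintro ⟨b, ⟨p, q⟩, ⟨_, hq, _⟩, rfl⟩
    exact ⟨q, hq⟩

end Isomorphism

/-! ### Labelled trees with every subtree repeated infinitely often -/

section LabelledTree

/-- Adjacency in the tree of finite sequences of natural numbers. -/
def treeAdj : List ℕ → List ℕ → Prop
  | [], [] => False
  | [], _ :: v => v = []
  | _ :: u, [] => u = []
  | n :: u, m :: v => n = m ∧ treeAdj u v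

theorem treeAdj_symm : ∀ {u v : List ℕ}, treeAdj u v → treeAdj v u
  | [], [], h => h
  | [], _ :: _, h => h
  | _ :: _, [], h => h
  | _ :: _, _ :: _, h => ⟨h.1.symm, treeAdj_symm h.2⟩

theorem treeAdj_irrefl : ∀ u : List ℕ, ¬ treeAdj u u
  | [], h => h
  | _ :: u, h => treeAdj_irrefl u h.2

theorem treeAdj_append_singleton (m : ℕ) : ∀ u : List ℕ, treeAdj u (u ++ [m])
  | [] => rfl
  | _ :: u => ⟨rfl, treeAdj_append_singleton m u⟩

theorem treeAdj_nil_iff {u : List ℕ} : treeAdj [] u ↔ ∃ n, u = [n] := by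
  cases u <;> simp [treeAdj]

/-- Isomorphism of labellings of the tree of finite sequences, as labelled rooted trees. -/
def TreeIso (ℓ ℓ' : List ℕ → ℕ) : Prop :=
  ∃ φ : List ℕ ≃ List ℕ, φ [] = [] ∧ (∀ u v, treeAdj (φ u) (φ v) ↔ treeAdj u v) ∧
    ∀ u, ℓ' (φ u) = ℓ u

@[refl]
theorem TreeIso.refl (ℓ : List ℕ → ℕ) : TreeIso ℓ ℓ :=
  ⟨Equiv.refl _, rfl, fun _ _ => Iff.rfl, fun _ => rfl⟩

theorem TreeIso.symm {ℓ ℓ' : List ℕ → ℕ} (h : TreeIso ℓ ℓ') : TreeIso ℓ' ℓ := by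
  obtain ⟨φ, h1, h2, h3⟩ := h
  refine ⟨φ.symm, ?_, fun u v => ?_, fun u => ?_⟩
  · rw [Equiv.symm_apply_eq, h1]
  · rw [← h2, Equiv.apply_symm_apply, Equiv.apply_symm_apply]
  · rw [← h3, Equiv.apply_symm_apply]

theorem TreeIso.trans {ℓ ℓ' ℓ'' : List ℕ → ℕ} (h : TreeIso ℓ ℓ') (h' : TreeIso ℓ' ℓ'') :
    TreeIso ℓ ℓ'' := by
  obtain ⟨φ, h1, h2, h3⟩ := h
  obtain ⟨ψ, h1', h2', h3'⟩ := h'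
  exact ⟨φ.trans ψ, by simp [h1, h1'], fun u v => by simp [h2, h2'], fun u => by simp [h3, h3']⟩

/-- Isomorphism types of labellings of the tree of finite sequences. -/
def treeSetoid : Setoid (List ℕ → ℕ) :=
  ⟨TreeIso, TreeIso.refl, TreeIso.symm, TreeIso.trans⟩

/-- The labelled tree whose root has label `l` and, for each `i`, infinitely many copies of `S i`
as immediate subtrees. -/
def node (l : ℕ) (S : ℕ → List ℕ → ℕ) : List ℕ → ℕ
  | [] => l
  | n :: t => S n.unpair.1 t

/-- Each value is taken infinitely often after `Nat.unpair`, so corresponding fibres are both empty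
or both countably infinite and can be matched. -/
theorem exists_perm_unpair {C : Type*} {F G : ℕ → C} (h : range F = range G) :
    ∃ σ : ℕ ≃ ℕ, ∀ n, G (σ n).unpair.1 = F n.unpair.1 := by
  have hinf : ∀ (F : ℕ → C) (c : C), c ∈ range F → Infinite {n : ℕ // F n.unpair.1 = c} := by
    rintro F _ ⟨k, rfl⟩
    refine Infinite.of_injective (fun j : ℕ => ⟨Nat.pair k j, by simp⟩) fun i j hij => ?_
    have := congrArg Subtype.val hij
    simpa using this
  have he : ∀ c, Nonempty ({n : ℕ // F n.unpair.1 = c} ≃ {n : ℕ // G n.unpair.1 = c}) := fun c => by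
    by_cases hc : c ∈ range F
    · have := hinf F c hc
      have := hinf G c (h ▸ hc)
      exact nonempty_equiv_of_countable
    · have : IsEmpty {n : ℕ // F n.unpair.1 = c} := ⟨fun n => hc ⟨_, n.2⟩⟩
      have : IsEmpty {n : ℕ // G n.unpair.1 = c} := ⟨fun n => hc (h ▸ ⟨_, n.2⟩)⟩
      exact ⟨Equiv.equivOfIsEmpty _ _⟩
  have e := fun c => (he c).some
  refine ⟨(Equiv.sigmaFiberEquiv fun n : ℕ => F n.unpair.1).symm.trans
    ((Equiv.sigmaCongrRight e).trans (Equiv.sigmaFiberEquiv fun n : ℕ => G n.unpair.1)),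
    fun n => ?_⟩
  exact (e (F n.unpair.1) ⟨n, rfl⟩).2

theorem TreeIso.node_of_perm {l : ℕ} {S S' : ℕ → List ℕ → ℕ} (σ : ℕ ≃ ℕ)
    (h : ∀ n, TreeIso (S n.unpair.1) (S' (σ n).unpair.1)) : TreeIso (node l S) (node l S') := by
  choose φ h1 h2 h3 using h
  let f : List ℕ → List ℕ := fun u => match u with
    | [] => []
    | n :: t => σ n :: φ n t
  let g : List ℕ → List ℕ := fun u => match u with
    | [] => []
    | m :: t => σ.symm m :: (φ (σ.symm m)).symm t
  have hfg : ∀ u, f (g u) = u := fun u => match u with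
    | [] => rfl
    | m :: t => by simp [f, g]
  have hgf : ∀ u, g (f u) = u := fun u => match u with
    | [] => rfl
    | m :: t => by simp [f, g]
  have hnil : ∀ n t, φ n t = [] ↔ t = [] := fun n t => by
    rw [← (φ n).apply_eq_iff_eq (x := t), h1]
  refine ⟨⟨f, g, hgf, hfg⟩, rfl, fun u v => ?_, fun u => ?_⟩
  · show treeAdj (f u) (f v) ↔ _
    match u, v with
    | [], [] => exact Iff.rfl
    | [], m :: v => exact hnil m v
    | n :: u, [] => exact hnil n u
    | n :: u, m :: v =>
      simp only [f, treeAdj, σ.apply_eq_iff_eq]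
      refine and_congr_right fun hnm => ?_
      subst hnm
      exact h2 n u v
  · match u with
    | [] => rfl
    | n :: t => exact h3 n t

/-- Infinite repetition removes multiplicities: only the set of isomorphism types of immediate
subtrees matters. -/
theorem TreeIso.node {l : ℕ} {S S' : ℕ → List ℕ → ℕ} (h : ∀ i, ∃ j, TreeIso (S i) (S' j))
    (h' : ∀ j, ∃ i, TreeIso (S i) (S' j)) : TreeIso (node l S) (node l S') := by
  obtain ⟨σ, hσ⟩ := exists_perm_unpair (F := fun i => Quotient.mk treeSetoid (S i))
    (G := fun i => Quotient.mk treeSetoid (S' i)) (by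
      ext c
      constructor
      · rintro ⟨i, rfl⟩
        obtain ⟨j, hj⟩ := h i
        exact ⟨j, (Quotient.sound (s := treeSetoid) hj).symm⟩
      · rintro ⟨j, rfl⟩
        obtain ⟨i, hi⟩ := h' j
        exact ⟨i, Quotient.sound (s := treeSetoid) hi⟩)
  exact TreeIso.node_of_perm σ fun n => (Quotient.exact (s := treeSetoid) (hσ n)).symm

theorem TreeIso.root_eq {l l' : ℕ} {S S' : ℕ → List ℕ → ℕ}
    (h : TreeIso (CountableModels.node l S) (CountableModels.node l' S')) : l = l' := by
  obtain ⟨φ, h1, -, h3⟩ := h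
  have := h3 []
  rw [h1] at this
  exact this.symm

/-- A path can leave a branch only through the root, which `φ` fixes, so each branch is mapped into
a single branch. -/
theorem exists_head_of_treeAdj {φ : List ℕ ≃ List ℕ} (h1 : φ [] = [])
    (h2 : ∀ u v, treeAdj (φ u) (φ v) ↔ treeAdj u v) (n : ℕ) :
    ∃ m, ∀ t, ∃ t', φ (n :: t) = m :: t' := by
  have hadj := (h2 [] [n]).2 rfl
  rw [h1] at hadj
  obtain ⟨m, hm⟩ := treeAdj_nil_iff.1 hadj
  refine ⟨m, fun t => ?_⟩
  induction t using List.reverseRecOn with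
  | nil => exact ⟨[], hm⟩
  | append_singleton t k ih =>
    obtain ⟨t', ht'⟩ := ih
    have hadj := (h2 (n :: t) (n :: t ++ [k])).2 (treeAdj_append_singleton k _)
    rw [ht'] at hadj
    match hφ : φ (n :: t ++ [k]) with
    | [] =>
      rw [← h1] at hφ
      exact absurd (φ.injective hφ) (by simp)
    | m' :: t'' =>
      rw [hφ] at hadj
      obtain rfl := hadj.1
      exact ⟨t'', rfl⟩

theorem TreeIso.exists_subtree {l l' : ℕ} {S S' : ℕ → List ℕ → ℕ}
    (h : TreeIso (CountableModels.node l S) (CountableModels.node l' S')) (i : ℕ) :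
    ∃ j, TreeIso (S i) (S' j) := by
  obtain ⟨φ, h1, h2, h3⟩ := h
  have h1' : φ.symm [] = [] := by rw [Equiv.symm_apply_eq, h1]
  have h2' : ∀ u v, treeAdj (φ.symm u) (φ.symm v) ↔ treeAdj u v := fun u v => by
    rw [← h2, Equiv.apply_symm_apply, Equiv.apply_symm_apply]
  obtain ⟨m, hm⟩ := exists_head_of_treeAdj h1 h2 (Nat.pair i 0)
  obtain ⟨n, hn⟩ := exists_head_of_treeAdj h1' h2' m
  choose f hf using hm
  choose g hg using hn
  have hgf : ∀ t, n = Nat.pair i 0 ∧ g (f t) = t := fun t => by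
    have := hg (f t)
    rw [← hf, Equiv.symm_apply_apply] at this
    simpa [eq_comm] using this
  have hn := (hgf []).1
  have hfg : ∀ t, f (g t) = t := fun t => by
    have := hf (g t)
    rw [← hn, ← hg, Equiv.apply_symm_apply] at this
    simpa [eq_comm] using this
  refine ⟨m.unpair.1, ⟨f, g, fun t => (hgf t).2, hfg⟩, ?_, fun u v => ?_, fun u => ?_⟩
  · have hadj := (h2 [] [Nat.pair i 0]).2 rfl
    rw [h1, hf] at hadj
    exact hadj
  · have := h2 (Nat.pair i 0 :: u) (Nat.pair i 0 :: v)
    rw [hf, hf] at this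
    simpa [treeAdj] using this
  · have := h3 (Nat.pair i 0 :: u)
    rw [hf] at this
    simpa [CountableModels.node] using this

theorem TreeIso.of_node_const {l l' : ℕ} {B B' : List ℕ → ℕ}
    (h : TreeIso (CountableModels.node l fun _ => B) (CountableModels.node l' fun _ => B')) :
    TreeIso B B' :=
  let ⟨_, hj⟩ := h.exists_subtree 0
  hj

theorem TreeIso.node_const {l : ℕ} {B B' : List ℕ → ℕ} (h : TreeIso B B') :
    TreeIso (CountableModels.node l fun _ => B) (CountableModels.node l fun _ => B') :=
  TreeIso.node (fun _ => ⟨0, h⟩) fun _ => ⟨0, h⟩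

end LabelledTree

/-! ### Continuous reduction of Borel sets to tree isomorphism -/

section Reduction

/-- `X` is continuously reducible to isomorphism of labelled trees, with a fixed pair of
nonisomorphic values. -/
def TreeReducible (X : Set (ℕ → Bool)) : Prop :=
  ∃ (P Q : List ℕ → ℕ) (A : (ℕ → Bool) → List ℕ → ℕ), ¬ TreeIso P Q ∧ Continuous A ∧
    (∀ x ∈ X, TreeIso (A x) P) ∧ ∀ x ∉ X, TreeIso (A x) Q

theorem TreeReducible.of_isClopen {X : Set (ℕ → Bool)} (hX : IsClopen X) : TreeReducible X := by
  classical
  refine ⟨node 0 fun _ _ => 0, node 1 fun _ _ => 0,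
    fun x => if x ∈ X then node 0 fun _ _ => 0 else node 1 fun _ _ => 0,
    fun h => zero_ne_one h.root_eq, ?_, fun x hx => ?_, fun x hx => ?_⟩
  · refine continuous_if (fun x hx => ?_) continuousOn_const continuousOn_const
    have hx' : x ∈ frontier X := hx
    rw [hX.frontier_eq] at hx'
    exact hx'.elim
  · simp only [hx, if_true]
    exact TreeIso.refl _
  · simp only [hx, if_false]
    exact TreeIso.refl _

theorem TreeReducible.compl {X : Set (ℕ → Bool)} (hX : TreeReducible X) : TreeReducible Xᶜ := by
  obtain ⟨P, Q, A, hPQ, hA, h1, h2⟩ := hX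
  exact ⟨Q, P, A, fun h => hPQ h.symm, hA, h2, fun x hx => h1 x (notMem_compl_iff.1 hx)⟩

theorem continuous_node {Z : Type*} [TopologicalSpace Z] (l : ℕ) {S : Z → ℕ → List ℕ → ℕ}
    (hS : ∀ i, Continuous fun x => S x i) : Continuous fun x => node l (S x) := by
  refine continuous_pi fun u => ?_
  match u with
  | [] => exact continuous_const
  | n :: t => exact (continuous_apply t).comp (hS _)

/-- By disjointness `T x` is of type `R k` if `x ∈ X k`, and of type `R'` if `x` is in no `X k`.
Adding all the `R k` as siblings of `T x` hides which `k` occurred. -/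
theorem TreeReducible.iUnion {X : ℕ → Set (ℕ → Bool)} (hd : Pairwise (Function.onFun Disjoint X))
    (hX : ∀ n, TreeReducible (X n)) : TreeReducible (⋃ n, X n) := by
  choose P Q A hPQ hA hin hout using hX
  -- The root label `n` keeps subtrees for different `n` nonisomorphic.
  let tag : ℕ → (List ℕ → ℕ) → List ℕ → ℕ := fun n B => node n fun _ => B
  let R : ℕ → List ℕ → ℕ := fun k => node 0 fun n => if n = k then tag n (P n) else tag n (Q n)
  let R' : List ℕ → ℕ := node 0 fun n => tag n (Q n)
  let T : (ℕ → Bool) → List ℕ → ℕ := fun x => node 0 fun n => tag n (A n x)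
  have hR : ∀ k, ¬ TreeIso (R k) R' := fun k h => by
    obtain ⟨n, hn⟩ := h.exists_subtree k
    simp only [if_true] at hn
    obtain rfl := hn.root_eq
    exact hPQ k hn.of_node_const
  have hT : ∀ k, ∀ x ∈ X k, TreeIso (T x) (R k) := fun k x hx => by
    have : ∀ n, TreeIso (tag n (A n x)) (if n = k then tag n (P n) else tag n (Q n)) := fun n => by
      split_ifs with h
      · subst h
        exact (hin n x hx).node_const
      · exact (hout n x fun hx' => disjoint_left.1 (hd h) hx' hx).node_const
    exact TreeIso.node (fun n => ⟨n, this n⟩) fun n => ⟨n, this n⟩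
  have hT' : ∀ x ∉ ⋃ k, X k, TreeIso (T x) R' := fun x hx => by
    have : ∀ n, TreeIso (tag n (A n x)) (tag n (Q n)) := fun n =>
      (hout n x fun h => hx (mem_iUnion.2 ⟨n, h⟩)).node_const
    exact TreeIso.node (fun n => ⟨n, this n⟩) fun n => ⟨n, this n⟩
  let cons : (List ℕ → ℕ) → ℕ → List ℕ → ℕ := fun B i => Nat.casesOn i B R
  refine ⟨node 0 R, node 0 (cons R'), fun x => node 0 (cons (T x)), fun h => ?_,
    continuous_node 0 fun i => ?_, fun x hx => ?_, fun x hx => ?_⟩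
  · obtain ⟨k, hk⟩ := h.symm.exists_subtree 0
    exact hR k hk.symm
  · cases i with
    | zero => exact continuous_node 0 fun n => continuous_node n fun _ => hA n
    | succ k => exact continuous_const
  · obtain ⟨k, hk⟩ := mem_iUnion.1 hx
    refine TreeIso.node (fun i => ?_) fun j => ⟨j + 1, TreeIso.refl _⟩
    cases i with
    | zero => exact ⟨k, hT k x hk⟩
    | succ k => exact ⟨k, TreeIso.refl _⟩
  · have : ∀ i, TreeIso (cons (T x) i) (cons R' i) := fun i => by
      cases i with
      | zero => exact hT' x hx
      | succ k => exact TreeIso.refl _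
    exact TreeIso.node (fun i => ⟨i, this i⟩) fun i => ⟨i, this i⟩

/-- The π-λ theorem from clopen sets needs only complements and disjoint unions. -/
theorem treeReducible_of_measurableSet {X : Set (ℕ → Bool)} (hX : MeasurableSet X) :
    TreeReducible X := by
  have hgen : (inferInstance : MeasurableSpace (ℕ → Bool)) =
      MeasurableSpace.generateFrom {s | IsClopen s} :=
    BorelSpace.measurable_eq.trans isTopologicalBasis_isClopen.borel_eq_generateFrom
  refine MeasurableSpace.induction_on_inter (C := fun s _ => TreeReducible s) hgen
    (fun s hs t ht _ => IsClopen.inter hs ht) (TreeReducible.of_isClopen isClopen_empty)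
    (fun s hs => TreeReducible.of_isClopen hs) (fun s _ hs => hs.compl)
    (fun f hd _ hf => TreeReducible.iUnion hd hf) X hX

end Reduction

/-! ### Coding labelled trees by graphs -/

section DecoratedTree

/-- The tree of finite sequences, with a pendant vertex `(u, i)` attached to `u` if `D u i`; the
other vertices `(u, i)` are isolated. -/
def decoratedTree (D : List ℕ → ℕ → Prop) : SimpleGraph (List ℕ ⊕ List ℕ × ℕ) where
  Adj
    | .inl u, .inl v => treeAdj u v
    | .inl u, .inr p => u = p.1 ∧ D p.1 p.2
    | .inr p, .inl u => u = p.1 ∧ D p.1 p.2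
    | .inr _, .inr _ => False
  symm := ⟨fun
    | .inl _, .inl _, h => treeAdj_symm h
    | .inl _, .inr _, h => h
    | .inr _, .inl _, h => h⟩
  loopless := ⟨fun
    | .inl u, h => treeAdj_irrefl u h⟩

/-- The number of pendant vertices at `u` in the graph coding the labelled tree `ℓ`. Only the root
has an even number of them. -/
def pendantCount (ℓ : List ℕ → ℕ) (u : List ℕ) : ℕ := 2 * ℓ u + if u = [] then 0 else 1

/-- The graph coding a labelled tree. -/
abbrev treeGraph (ℓ : List ℕ → ℕ) : SimpleGraph (List ℕ ⊕ List ℕ × ℕ) :=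
  decoratedTree fun u i => i < pendantCount ℓ u

theorem TreeIso.nonempty_iso {ℓ ℓ' : List ℕ → ℕ} (h : TreeIso ℓ ℓ') :
    Nonempty (treeGraph ℓ ≃g treeGraph ℓ') := by
  obtain ⟨φ, h1, h2, h3⟩ := h
  have hc : ∀ u, pendantCount ℓ' (φ u) = pendantCount ℓ u := fun u => by
    have : φ u = [] ↔ u = [] := by rw [← φ.apply_eq_iff_eq (x := u), h1]
    simp only [pendantCount, h3, this]
  refine ⟨⟨Equiv.sumCongr φ (Equiv.prodCongr φ (Equiv.refl ℕ)), fun {a b} => ?_⟩⟩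
  match a, b with
  | .inl u, .inl v => exact h2 u v
  | .inl u, .inr p => exact and_congr φ.apply_eq_iff_eq (by simp [hc])
  | .inr p, .inl u => exact and_congr φ.apply_eq_iff_eq (by simp [hc])
  | .inr _, .inr _ => exact Iff.rfl

/-- A tree vertex has infinitely many neighbours, any other vertex at most one. -/
theorem exists_apply_inl_eq {D D' : List ℕ → ℕ → Prop}
    (ψ : decoratedTree D ≃g decoratedTree D') (u : List ℕ) : ∃ v, ψ (.inl u) = .inl v := by
  match h : ψ (.inl u) with
  | .inl v => exact ⟨v, rfl⟩
  | .inr p =>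
    exfalso
    have key : ∀ k, ψ (.inl (u ++ [k])) = .inl p.1 := fun k => by
      have hadj : (decoratedTree D').Adj (ψ (.inl u)) (ψ (.inl (u ++ [k]))) :=
        ψ.map_adj_iff.2 (treeAdj_append_singleton k u)
      rw [h] at hadj
      match h' : ψ (.inl (u ++ [k])) with
      | .inl w =>
        rw [h'] at hadj
        rw [hadj.1]
      | .inr q =>
        rw [h'] at hadj
        exact hadj.elim
    have := ψ.injective ((key 0).trans (key 1).symm)
    simp at this

theorem pendantCount_le {ℓ ℓ' : List ℕ → ℕ} (ψ : treeGraph ℓ ≃g treeGraph ℓ') {u v : List ℕ}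
    (h : ψ (.inl u) = .inl v) : pendantCount ℓ u ≤ pendantCount ℓ' v := by
  have key : ∀ i : Fin (pendantCount ℓ u), ∃ j : Fin (pendantCount ℓ' v),
      ψ (.inr (u, i)) = .inr (v, j) := fun i => by
    have hadj : (treeGraph ℓ').Adj (ψ (.inl u)) (ψ (.inr (u, i))) :=
      ψ.map_adj_iff.2 ⟨rfl, i.2⟩
    rw [h] at hadj
    match h' : ψ (.inr (u, i)) with
    | .inl w =>
      obtain ⟨w', hw'⟩ := exists_apply_inl_eq ψ.symm w
      rw [← h', RelIso.symm_apply_apply] at hw'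
      cases hw'
    | .inr (w, j) =>
      rw [h'] at hadj
      obtain ⟨hvw, hj⟩ := hadj
      dsimp only at hvw hj
      subst hvw
      exact ⟨⟨j, hj⟩, rfl⟩
  choose f hf using key
  have hinj : Function.Injective f := fun i j hij => by
    have := ψ.injective (((hf i).trans (by rw [hij])).trans (hf j).symm)
    simpa [Fin.ext_iff] using this
  simpa using Fintype.card_le_of_injective f hinj

theorem treeIso_of_iso {ℓ ℓ' : List ℕ → ℕ} (ψ : treeGraph ℓ ≃g treeGraph ℓ') : TreeIso ℓ ℓ' := by
  choose f hf using exists_apply_inl_eq ψ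
  choose g hg using exists_apply_inl_eq ψ.symm
  have hfg : ∀ v, f (g v) = v := fun v => by
    have := hf (g v)
    rw [← hg, RelIso.apply_symm_apply] at this
    exact (Sum.inl.inj this).symm
  have hgf : ∀ u, g (f u) = u := fun u => by
    have := hg (f u)
    rw [← hf, RelIso.symm_apply_apply] at this
    exact (Sum.inl.inj this).symm
  have hc : ∀ u, pendantCount ℓ u = pendantCount ℓ' (f u) := fun u => by
    refine le_antisymm (pendantCount_le ψ (hf u)) (pendantCount_le ψ.symm ?_)
    rw [hg, hgf]
  refine ⟨⟨f, g, hgf, hfg⟩, ?_, fun u v => ?_, fun u => ?_⟩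
  -- Parity of the pendant count forces the root to go to the root.
  · have := hc []
    by_contra hne
    have hne' : f [] ≠ [] := hne
    simp only [pendantCount, if_true, if_neg hne'] at this
    omega
  · have : (treeGraph ℓ').Adj (ψ (.inl u)) (ψ (.inl v)) ↔ _ := ψ.map_adj_iff
    rw [hf, hf] at this
    exact this
  · have := hc u
    show ℓ' (f u) = ℓ u
    simp only [pendantCount] at this
    split_ifs at this <;> omega

end DecoratedTree

/-! ### Diagonalisation: isomorphism of graphs is not Borel -/

section GraphSpace

instance countable_graph_symbols : Countable FirstOrder.Language.graph.Symbols := by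
  have : ∀ n, Countable (FirstOrder.Language.graph.Relations n) := fun n => inferInstance
  have : Countable (Σ n, FirstOrder.Language.graph.Relations n) := inferInstance
  have : Countable (Σ n, FirstOrder.Language.graph.Functions n) := inferInstance
  exact inferInstanceAs (Countable ((Σ n, FirstOrder.Language.graph.Functions n) ⊕
    (Σ n, FirstOrder.Language.graph.Relations n)))

/-- An enumeration of the vertices of the decorated trees. -/
def vertexEquiv : ℕ ≃ List ℕ ⊕ List ℕ × ℕ := (Denumerable.eqv _).symm

/-- A copy of the decorated tree with domain `ℕ`. -/
def decoratedGraph (D : List ℕ → ℕ → Prop) : graphs :=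
  ⟨((decoratedTree D).comap vertexEquiv).structure, FirstOrder.Language.simpleGraph_model _⟩

theorem mem_isoRel_decoratedGraph_iff {D D' : List ℕ → ℕ → Prop} :
    (decoratedGraph D, decoratedGraph D') ∈ isoRel graphs ↔
      Nonempty (decoratedTree D ≃g decoratedTree D') := by
  constructor
  · rintro ⟨e⟩
    let e' : ℕ ≃ ℕ := @FirstOrder.Language.Equiv.toEquiv _ ℕ ℕ (decoratedGraph D).1
      (decoratedGraph D').1 e
    have he : ∀ a b, (decoratedTree D').Adj (vertexEquiv (e' a)) (vertexEquiv (e' b)) ↔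
        (decoratedTree D).Adj (vertexEquiv a) (vertexEquiv b) := fun a b =>
      @FirstOrder.Language.Equiv.map_rel' _ ℕ ℕ (decoratedGraph D).1 (decoratedGraph D').1 e 2
        FirstOrder.Language.adj ![a, b]
    refine ⟨⟨(vertexEquiv.symm.trans e').trans vertexEquiv, fun {a b} => ?_⟩⟩
    simpa using he (vertexEquiv.symm a) (vertexEquiv.symm b)
  · rintro ⟨ψ⟩
    refine ⟨@FirstOrder.Language.Equiv.mk _ ℕ ℕ (decoratedGraph D).1 (decoratedGraph D').1
      ((vertexEquiv.trans ψ.toEquiv).trans vertexEquiv.symm) (fun f => isEmptyElim f)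
      (fun r x => ?_)⟩
    cases r
    show (decoratedTree D').Adj (vertexEquiv (vertexEquiv.symm (ψ (vertexEquiv (x 0)))))
      (vertexEquiv (vertexEquiv.symm (ψ (vertexEquiv (x 1))))) ↔
      (decoratedTree D).Adj (vertexEquiv (x 0)) (vertexEquiv (x 1))
    rw [Equiv.apply_symm_apply, Equiv.apply_symm_apply]
    exact ψ.map_adj_iff

theorem measurable_decoratedGraph {Z : Type*} [MeasurableSpace Z] {D : Z → List ℕ → ℕ → Prop}
    (hD : ∀ u i, MeasurableSet {z | D z u i}) : Measurable fun z => decoratedGraph (D z) := by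
  refine Measurable.subtype_mk (measurable_structure_iff.2 ⟨fun f => isEmptyElim f.2, ?_⟩)
  rintro ⟨_, ⟨⟩⟩ x
  show MeasurableSet {z | (decoratedTree (D z)).Adj (vertexEquiv (x 0)) (vertexEquiv (x 1))}
  match vertexEquiv (x 0), vertexEquiv (x 1) with
  | .inl u, .inl v => exact MeasurableSet.const (treeAdj u v)
  | .inl u, .inr p => exact (MeasurableSet.const (u = p.1)).inter (hD p.1 p.2)
  | .inr p, .inl u => exact (MeasurableSet.const (u = p.1)).inter (hD p.1 p.2)
  | .inr _, .inr _ => exact MeasurableSet.const False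

/-- A universal parametrisation: `c` codes, for each `b`, an open family of decorations. -/
def openDecoration (c x : ℕ → Bool) (b : Bool) (u : List ℕ) (i : ℕ) : Prop :=
  ∃ n, c (Encodable.encode (PiNat.res x n, b, u, i)) = true

/-- A witness `n` inspects only the first `n` bits of `c` and one further bit, so the diagonal
condition is open. -/
theorem measurableSet_openDecoration (b : Bool) (u : List ℕ) (i : ℕ) :
    MeasurableSet {c | openDecoration c c b u i} := by
  refine IsOpen.measurableSet (isOpen_iff_forall_mem_open.2 ?_)
  rintro c ⟨n, hn⟩
  refine ⟨PiNat.cylinder c n ∩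
    (fun c' : ℕ → Bool => c' (Encodable.encode (PiNat.res c n, b, u, i))) ⁻¹' {true},
    fun c' hc' => ⟨n, ?_⟩, ?_, PiNat.self_mem_cylinder c n, hn⟩
  · have h := hc'.1
    rw [PiNat.cylinder_eq_res] at h
    have h' : PiNat.res c' n = PiNat.res c n := h
    rw [h']
    exact hc'.2
  · exact (PiNat.isOpen_cylinder _ c n).inter
      ((isOpen_discrete _).preimage (continuous_apply _))

theorem exists_openDecoration_eq {A : Bool → (ℕ → Bool) → List ℕ → ℕ}
    (hA : ∀ b, Continuous (A b)) :
    ∃ c, ∀ x b, openDecoration c x b = fun u i => i < pendantCount (A b x) u := by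
  classical
  -- The bit for `s` is on exactly when the whole cylinder of `s` lies in the required open set.
  refine ⟨fun m => match (Encodable.decode m : Option (List Bool × Bool × List ℕ × ℕ)) with
    | none => false
    | some (s, b, u, i) => decide (∀ y, PiNat.res y s.length = s → i < pendantCount (A b y) u),
    fun x b => ?_⟩
  funext u i
  simp only [openDecoration, Encodable.encodek, PiNat.res_length, decide_eq_true_eq, eq_iff_iff]
  refine ⟨fun ⟨n, hn⟩ => hn x rfl, fun h => ?_⟩
  have ho : IsOpen {y | i < pendantCount (A b y) u} :=
    (isOpen_discrete {k | i < 2 * k + if u = [] then 0 else 1}).preimage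
      ((continuous_apply u).comp (hA b))
  obtain ⟨_, ⟨z, n, rfl⟩, hz, hsub⟩ :=
    (PiNat.isTopologicalBasis_cylinders fun _ => Bool).exists_subset_of_mem_open
      (show x ∈ {y | i < pendantCount (A b y) u} from h) ho
  refine ⟨n, fun y hy => hsub ?_⟩
  rw [← PiNat.mem_cylinder_iff_eq.1 hz, PiNat.cylinder_eq_res]
  exact hy

/-- Isomorphism of graphs with domain `ℕ` is not Borel. -/
theorem not_measurableSet_isoRel_graphs : ¬ MeasurableSet (isoRel graphs) := by
  intro hU
  have hm : ∀ b, Measurable fun c => decoratedGraph (openDecoration c c b) := fun b =>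
    measurable_decoratedGraph (measurableSet_openDecoration b)
  obtain ⟨P, Q, A, hPQ, hA, hin, hout⟩ :=
    treeReducible_of_measurableSet (((hm false).prodMk (hm true)) hU).compl
  -- This `c` codes the reduction `A` at `false` and the constant tree `P` at `true`; evaluated at
  -- `c` itself, the two graphs are isomorphic if and only if they are not.
  obtain ⟨c, hc⟩ := exists_openDecoration_eq (A := fun b => bif b then fun _ => P else A)
    fun b => by
      cases b
      exacts [hA, continuous_const]
  have hiff : (decoratedGraph (openDecoration c c false),
      decoratedGraph (openDecoration c c true)) ∈ isoRel graphs ↔ TreeIso (A c) P := by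
    rw [hc, hc, mem_isoRel_decoratedGraph_iff]
    exact ⟨fun ⟨ψ⟩ => treeIso_of_iso ψ, TreeIso.nonempty_iso⟩
  by_cases h : (decoratedGraph (openDecoration c c false),
      decoratedGraph (openDecoration c c true)) ∈ isoRel graphs
  · exact hPQ ((hiff.1 h).symm.trans (hout c fun hc' => hc' h))
  · exact h (hiff.2 (hin c h))

end GraphSpace

end CountableModels

theorem proposition1p2 (L : FirstOrder.Language.{u, v}) [Countable L.Symbols]
    (K : Set (L.Structure ℕ)) (hK : MeasurableSet K)
    (hAut : ∀ A ∈ K, Countable (CountableModels.Aut A)) :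
    MeasurableSet (CountableModels.isoRel K) ∧ ¬ CountableModels.BorelComplete K := by
  have h := CountableModels.measurableSet_isoRel hK hAut
  refine ⟨h, ?_⟩
  rintro ⟨f, hf, hiff⟩
  refine CountableModels.not_measurableSet_isoRel_graphs ?_
  convert ((hf.comp measurable_fst).prodMk (hf.comp measurable_snd)) h using 1
  ext p
  exact hiff p.1 p.2
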